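/- Consider $n$ sensors; sensor $i$ measures $y_i(t)=\alpha_i x(t)+\beta_i$, where $\alpha_i,\beta_i\in\mathbb{R}$ are constants and $\{x(t)\}_{t\ge 0}$ is an i.i.d. real sequence with $E\{x(t)\}=\bar x$, $E\{x(t)^2\}=s^2<\infty$ and $s^2-\bar x^2={\rm var}\{x(t)\}>0$. The sensors are the nodes $\mathcal N=\{1,\dots,n\}$ of a directed graph, $\mathcal N_i$ is the set of nodes $j$ with an arc from $j$ to $i$, and $\gamma_{ij}\ge 0$ are weights with $\gamma_{ij}=0$ for $j\notin\mathcal N_i$. Let $\mathcal N^f=\{k_1,\dots,k_m\}\subseteq\mathcal N$ be a nonempty set of sensors held fixed, and let $\mathcal N\setminus\mathcal N^f=\{l_1,\dots,l_{n-m}\}$. Suppose that $\alpha_i\ne 0$ and $\gamma_{ij}>0$ for all $i\in\mathcal N\setminus\mathcal N^f$ and $j\in\mathcal N_i$ (the condition on $\alpha_i$ being required also if $\mathcal N_i=\emptyset$), and that every node of $\mathcal N\setminus\mathcal N^f$ is reachable by a directed walk from every node of $\mathcal N^f$. For a constant step size $\delta>0$ let $\hat\theta_i(t)=[\hat a_i(t)\;\hat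 b_i(t)]^T$ be generated as follows, with $\hat z_i(t)=\hat a_i(t)y_i(t)+\hat b_i(t)$: for $i\in\mathcal N\setminus\mathcal N^f$, $$\hat\theta_i(0)=\begin{bmatrix}1\\0\end{bmatrix},\qquad \hat\theta_i(t+1)=\hat\theta_i(t)+\delta\sum_{j\in\mathcal N_i}\gamma_{ij}\,(\hat z_j(t)-\hat z_i(t))\begin{bmatrix}y_i(t)\\1\end{bmatrix},$$ and for $k\in\mathcal N^f$, $\hat\theta_k(t)=\theta_{k0}$ for all $t$, where $\theta_{k0}\in\mathbb R^2$ is arbitrary. Put $$\hat\rho_i(t)=\begin{bmatrix}\alpha_i&0\\ \beta_i&1\end{bmatrix}\hat\theta_i(t),\qquad \hat\rho^f(t)=[\hat\rho_{l_1}(t)^T\cdots\hat\rho_{l_{n-m}}(t)^T]^T,\qquad \tilde\rho^f=[\rho_{k_1}^{fT}\cdots\rho_{k_m}^{fT}]^T,\quad \rho^f_k=\begin{bmatrix}\alpha_k&0\\ \beta_k&1\end{bmatrix}\theta_{k0}.$$ Let $\Gamma$ be the $n\times n$ matrix with entries $\gamma_{ij}$ for $i\ne j$ and $-\sum_{j\ne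 i}\gamma_{ij}$ for $i=j$, let $\Gamma^f$ be obtained from $\Gamma$ by deleting the rows and columns with indices $k_1,\dots,k_m$, and let $\tilde\Gamma^f=[\gamma_{l_pk_q}]_{p,q}$. Then $\Gamma^f\otimes I_2$ is invertible, and there exists $\delta''>0$ such that for all $0<\delta\le\delta''$, $$\hat\rho^f(t)\;\longrightarrow\;-(\Gamma^f\otimes I_2)^{-1}(\tilde\Gamma^f\otimes I_2)\,\tilde\rho^f\qquad(t\to\infty)$$ with probability one and, provided that $E\{x(t)^4\}<\infty$, also in the mean square sense (that is, $E\{\|\hat\rho^f(t)\|^2\}<\infty$ for all $t$ and the expected squared Euclidean distance of $\hat\rho^f(t)$ to the limit tends to $0$). -/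

import Mathlib

open MeasureTheory ProbabilityTheory Filter Topology
open scoped Kronecker Matrix

noncomputable section

/-- A network of `n` affine sensors. Sensor `i` reads `α i * x + β i` when the common signal has
the value `x`. The arc `graph.Adj j i` means that sensor `j` can send its messages to sensor `i`;
`γ i j` is the nonnegative weight that sensor `i` gives to the messages of sensor `j`, and it is
zero when `j` is not a neighbour of `i`. -/
structure SensorNetwork (n : ℕ) where
  graph : Digraph (Fin n)
  γ : Fin n → Fin n → ℝ
  α : Fin n → ℝ
  β : Fin n → ℝ
  γ_nonneg : ∀ i j, 0 ≤ γ i j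
  γ_eq_zero : ∀ i j, ¬ graph.Adj j i → γ i j = 0

namespace SensorNetwork

variable {n : ℕ} (S : SensorNetwork n)

open Classical in
/-- The neighbours of node `i`: the nodes that can send to `i`. -/
def nbr (i : Fin n) : Finset (Fin n) := Finset.univ.filter fun j => S.graph.Adj j i

/-- Node `i` is reachable from node `j`: there is a directed walk from `j` to `i`. -/
def Reachable (j i : Fin n) : Prop := Relation.ReflTransGen S.graph.Adj j i

/-- The measurement of sensor `i` when the signal has the value `ξ`. -/
def y (i : Fin n) (ξ : ℝ) : ℝ := S.α i * ξ + S.β i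

/-- The calibrated output of sensor `i` with calibration parameters `θ = (a, b)`. -/
def z (i : Fin n) (θ : Fin 2 → ℝ) (ξ : ℝ) : ℝ := θ 0 * S.y i ξ + θ 1

/-- The equivalent gain and offset `(a α i, a β i + b)` produced by the calibration parameters
`θ = (a, b)` of sensor `i`. -/
def rho (i : Fin n) (θ : Fin 2 → ℝ) : Fin 2 → ℝ := !![S.α i, 0; S.β i, 1] *ᵥ θ

/-- The blind calibration algorithm with constant step size `δ`, driven by the signal path
`x 0, x 1, …`, when the sensors of `F` are held fixed with the calibration parameters `θf`. The
other sensors start from `(1, 0)` and use the stochastic gradient recursion. -/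
def theta (F : Finset (Fin n)) (θf : Fin n → Fin 2 → ℝ) (δ : ℝ) (x : ℕ → ℝ) :
    ℕ → Fin n → Fin 2 → ℝ
  | 0 => fun i => if i ∈ F then θf i else ![1, 0]
  | t + 1 => fun i =>
      if i ∈ F then theta F θf δ x t i
      else theta F θf δ x t i +
        δ • ∑ j ∈ S.nbr i,
          (S.γ i j * (S.z j (theta F θf δ x t j) (x t) - S.z i (theta F θf δ x t i) (x t))) •
            ![S.y i (x t), 1]

/-- The stacked vector of gains and offsets of all adjusted (not fixed) sensors at time `t`. -/
def rhoAdj (F : Finset (Fin n)) (θf : Fin n → Fin 2 → ℝ) (δ : ℝ) (x : ℕ → ℝ) (t : ℕ) :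
    {i // i ∉ F} × Fin 2 → ℝ :=
  fun p => S.rho p.1 (S.theta F θf δ x t p.1) p.2

/-- The stacked vector of gains and offsets of the fixed sensors. -/
def rhoFixed (F : Finset (Fin n)) (θf : Fin n → Fin 2 → ℝ) : {i // i ∈ F} × Fin 2 → ℝ :=
  fun p => S.rho p.1 (θf p.1) p.2

/-- The matrix with off-diagonal entries `γ i j` and zero row sums. -/
def Gam : Matrix (Fin n) (Fin n) ℝ :=
  Matrix.of fun i j => if i = j then -∑ k ∈ Finset.univ.erase i, S.γ i k else S.γ i j

/-- `Gam` with the rows and columns of the fixed sensors deleted. -/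
def GamAdj (F : Finset (Fin n)) : Matrix {i // i ∉ F} {i // i ∉ F} ℝ :=
  S.Gam.submatrix Subtype.val Subtype.val

/-- The weights given by the adjusted sensors to the fixed sensors. -/
def GamFixed (F : Finset (Fin n)) : Matrix {i // i ∉ F} {i // i ∈ F} ℝ :=
  Matrix.of fun l k => S.γ l k

/-- The limit point `-(Γᶠ ⊗ I₂)⁻¹ (Γ̃ᶠ ⊗ I₂) ρ̃ᶠ`. -/
def rhoLim (F : Finset (Fin n)) (θf : Fin n → Fin 2 → ℝ) : {i // i ∉ F} × Fin 2 → ℝ :=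
  -((S.GamAdj F ⊗ₖ (1 : Matrix (Fin 2) (Fin 2) ℝ))⁻¹ *ᵥ
    ((S.GamFixed F ⊗ₖ (1 : Matrix (Fin 2) (Fin 2) ℝ)) *ᵥ S.rhoFixed F θf))

end SensorNetwork

/-- Mean square convergence of random vectors `X t` to the constant vector `L`: every `X t` is
square integrable and `E |X t - L|²` (Euclidean norm) tends to zero. -/
def TendstoMeanSquare {Ω κ : Type*} [MeasurableSpace Ω] [Fintype κ] (μ : Measure Ω)
    (X : ℕ → Ω → κ → ℝ) (L : κ → ℝ) : Prop :=
  (∀ t p, MemLp (fun ω => X t ω p) 2 μ) ∧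
    Tendsto (fun t => ∫ ω, ∑ p, (X t ω p - L p) ^ 2 ∂μ) atTop (𝓝 0)

end

/-! The limit point is an equilibrium for every value of the signal, not only on average
(`exists_equilibrium`). By linearity the error therefore obeys the same recursion with the fixed
sensors at zero (`step_sub`): the noise is purely multiplicative, which is why a constant step size
suffices.

By reachability, the Laplacian with the nodes of `F` grounded satisfies a minimum principle, so Γᶠ
is invertible and -(Γᶠ)⁻¹ is entrywise nonnegative. Solving c Γᶠ = -1 then gives positive weights d
(`exists_weights`). Let V = ∑ dᵢ|eᵢ|² and let W be the sum of the squared outputs of the error. One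
step with signal value ξ yields V' ≤ V - δW + δ²C(1+ξ²)W (`exists_energy_step_le`), and positive
variance with nonzero gains yields E W ≥ σV (`exists_energy_le_sum`).

Since W ≤ C(1+ξ²)V, the second order term is controlled in mean by a fourth moment, and then E V
contracts (`exists_contraction`). With second moments only, this bound need not be integrable, but
E√V still contracts (`exists_sqrt_contraction`): the root grows at most linearly in 1+ξ², and large
signals cost only a small tail of the second moment. The state is independent of the current signal,
so either contraction iterates. Geometric decay of E V gives mean square convergence; summability of
E√V gives almost sure convergence. -/

noncomputable section

/-! ### Grounded Laplacian: minimum principle and invertibility. -/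

namespace SensorNetwork

variable {n : ℕ} (S : SensorNetwork n)

/-- The weighted graph Laplacian (with zero row sums) applied to a function on the nodes. -/
def lap (f : Fin n → ℝ) (i : Fin n) : ℝ := ∑ j, S.γ i j * (f j - f i)

lemma sum_nbr_eq_lap (f : Fin n → ℝ) (i : Fin n) :
    ∑ j ∈ S.nbr i, S.γ i j * (f j - f i) = S.lap f i := by
  classical
  refine Finset.sum_subset (Finset.subset_univ _) fun j _ hj => ?_
  have : ¬ S.graph.Adj j i := by simpa [nbr] using hj
  rw [S.γ_eq_zero i j this, zero_mul]

/-- Minimum principle: a function that is nonnegative on `F` and superharmonic off `F` is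
nonnegative. -/
lemma nonneg_of_lap_nonpos {F : Finset (Fin n)} (hF : F.Nonempty)
    (hγ : ∀ i, i ∉ F → ∀ j ∈ S.nbr i, 0 < S.γ i j)
    (hreach : ∀ l, l ∉ F → ∀ k ∈ F, S.Reachable k l) {f : Fin n → ℝ}
    (hfF : ∀ i ∈ F, 0 ≤ f i) (hf : ∀ i, i ∉ F → S.lap f i ≤ 0) (i : Fin n) : 0 ≤ f i := by
  classical
  obtain ⟨m, -, hm⟩ := Finset.exists_min_image Finset.univ f ⟨i, Finset.mem_univ i⟩
  refine le_trans ?_ (hm i (Finset.mem_univ i))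
  by_contra! hneg
  have hnotF : ∀ a, f a = f m → a ∉ F := fun a ha haF => by
    have := hfF a haF
    linarith
  -- At a minimiser all terms of the Laplacian are nonnegative while their sum is not positive, so
  -- the minimum passes to every in-neighbour, and backwards along a walk into `F`.
  have hstep : ∀ a b, S.graph.Adj a b → f b = f m → f a = f m := by
    intro a b hab hb
    have hbF := hnotF b hb
    have ha : a ∈ S.nbr b := by simpa [nbr] using hab
    have hterm : ∀ j ∈ Finset.univ, 0 ≤ S.γ b j * (f j - f b) := fun j _ =>
      mul_nonneg (S.γ_nonneg b j) (by have := hm j (Finset.mem_univ j); linarith)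
    have hle := Finset.single_le_sum hterm (Finset.mem_univ a)
    have h0 : S.γ b a * (f a - f b) ≤ 0 := hle.trans (hf b hbF)
    have hpos := hγ b hbF a ha
    have := hm a (Finset.mem_univ a)
    nlinarith
  obtain ⟨k, hk⟩ := hF
  have hwalk : ∀ a b, S.Reachable a b → f b = f m → f a = f m := by
    intro a b hab
    induction hab with
    | refl => exact id
    | tail _ h ih => exact fun hb => ih (hstep _ _ h hb)
  exact hnotF k (hwalk k m (hreach m (hnotF m rfl) k hk) rfl) hk

lemma lap_eq_sum_sub (f : Fin n → ℝ) (i : Fin n) :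
    S.lap f i = ∑ j ∈ Finset.univ.erase i, S.γ i j * (f j - f i) := by
  classical
  rw [lap, ← Finset.add_sum_erase _ _ (Finset.mem_univ i)]
  simp

lemma lap_eq_sum_Gam (f : Fin n → ℝ) (i : Fin n) : S.lap f i = ∑ j, S.Gam i j * f j := by
  classical
  rw [lap_eq_sum_sub, ← Finset.add_sum_erase _ (fun j => S.Gam i j * f j) (Finset.mem_univ i)]
  have h : ∑ j ∈ Finset.univ.erase i, S.Gam i j * f j
      = ∑ j ∈ Finset.univ.erase i, S.γ i j * f j :=
    Finset.sum_congr rfl fun j hj => by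
      rw [Gam, Matrix.of_apply, if_neg (Finset.ne_of_mem_erase hj).symm]
  rw [h, Gam, Matrix.of_apply, if_pos rfl, neg_mul, Finset.sum_mul, neg_add_eq_sub,
    ← Finset.sum_sub_distrib]
  exact Finset.sum_congr rfl fun j _ => by ring

lemma sum_notMem_add_sum_mem (F : Finset (Fin n)) (f : Fin n → ℝ) :
    ∑ i : {i // i ∉ F}, f i + ∑ i : {i // i ∈ F}, f i = ∑ i, f i := by
  rw [add_comm, ← Fintype.sum_subtype_add_sum_subtype (fun i => i ∈ F)]
  congr!

lemma lap_eq_mulVec_add (F : Finset (Fin n)) (f : Fin n → ℝ) (i : {i // i ∉ F}) :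
    S.lap f i = (S.GamAdj F *ᵥ fun j => f j) i + (S.GamFixed F *ᵥ fun k => f k) i := by
  rw [lap_eq_sum_Gam, ← sum_notMem_add_sum_mem F]
  refine congrArg₂ (· + ·) rfl ?_
  refine Finset.sum_congr rfl fun k _ => ?_
  have hne : (i : Fin n) ≠ k := fun h => i.2 (h ▸ k.2)
  have : S.Gam i k = S.γ i k := by rw [Gam, Matrix.of_apply, if_neg hne]
  change S.Gam i k * f k = S.γ i k * f k
  rw [this]

/-- Extension by zero of a function on the adjusted nodes. -/
def extend (F : Finset (Fin n)) (c : {i // i ∉ F} → ℝ) (i : Fin n) : ℝ :=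
  if h : i ∉ F then c ⟨i, h⟩ else 0

@[simp] lemma extend_coe (F : Finset (Fin n)) (c : {i // i ∉ F} → ℝ) (i : {i // i ∉ F}) :
    extend F c i = c i := by
  simp [extend, i.2]

lemma extend_of_mem {F : Finset (Fin n)} (c : {i // i ∉ F} → ℝ) {i : Fin n} (hi : i ∈ F) :
    extend F c i = 0 := by
  simp [extend, hi]

lemma lap_extend (F : Finset (Fin n)) (c : {i // i ∉ F} → ℝ) (i : {i // i ∉ F}) :
    S.lap (extend F c) i = (S.GamAdj F *ᵥ c) i := by
  rw [lap_eq_mulVec_add S F]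
  have : (fun k : {k // k ∈ F} => extend F c k) = 0 := funext fun k => extend_of_mem c k.2
  simp [this]

section

variable {F : Finset (Fin n)} (hF : F.Nonempty)
    (hγ : ∀ i, i ∉ F → ∀ j ∈ S.nbr i, 0 < S.γ i j)
    (hreach : ∀ l, l ∉ F → ∀ k ∈ F, S.Reachable k l)
include hF hγ hreach

lemma nonneg_of_GamAdj_mulVec_nonpos {c : {i // i ∉ F} → ℝ}
    (hc : ∀ i, (S.GamAdj F *ᵥ c) i ≤ 0) (i : {i // i ∉ F}) : 0 ≤ c i := by
  have := S.nonneg_of_lap_nonpos hF hγ hreach (f := extend F c)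
    (fun i hi => (extend_of_mem c hi).ge)
    (fun i hi => by simpa [lap_extend S F c ⟨i, hi⟩] using hc ⟨i, hi⟩) i
  simpa using this

/-- The minimum principle applies to both c and -c for c in the kernel. -/
lemma isUnit_GamAdj : IsUnit (S.GamAdj F) := by
  rw [← Matrix.mulVec_injective_iff_isUnit]
  refine (injective_iff_map_eq_zero (S.GamAdj F).mulVecLin).2 fun c hc => funext fun i => ?_
  rw [Matrix.mulVecLin_apply] at hc
  refine le_antisymm ?_
    (S.nonneg_of_GamAdj_mulVec_nonpos hF hγ hreach (fun i => by rw [hc]; simp) i)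
  have := S.nonneg_of_GamAdj_mulVec_nonpos hF hγ hreach (c := -c)
    (fun i => by rw [Matrix.mulVec_neg, hc]; simp) i
  simpa using this

/-! ### Lyapunov weights and coercivity. -/

/-- Positive node weights for which the Laplacian is coercive in the weighted inner product. -/
lemma exists_weights : ∃ d : Fin n → ℝ, (∀ i, 0 ≤ d i) ∧ (∀ i, i ∉ F → 0 < d i) ∧
    (∀ i ∈ F, d i = 0) ∧
    ∀ j, j ∉ F → d j * ∑ k, S.γ j k - ∑ i, d i * S.γ i j = 1 := by
  classical
  have hu := S.isUnit_GamAdj hF hγ hreach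
  have hdet := (Matrix.isUnit_iff_isUnit_det _).1 hu
  set c : {i // i ∉ F} → ℝ := (fun _ => -1) ᵥ* (S.GamAdj F)⁻¹ with hc
  have hcG : c ᵥ* S.GamAdj F = fun _ => -1 := by
    rw [hc, Matrix.vecMul_vecMul, Matrix.nonsing_inv_mul _ hdet, Matrix.vecMul_one]
  have heq : ∀ j, j ∉ F →
      extend F c j * ∑ k, S.γ j k - ∑ i, extend F c i * S.γ i j = 1 := by
    intro j hj
    have h1 : ∑ i, extend F c i * S.Gam i j = -1 := by
      have := congrFun hcG ⟨j, hj⟩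
      have h0 : ∑ i : {i // i ∈ F}, extend F c i * S.Gam i j = 0 :=
        Fintype.sum_eq_zero _ fun i => by rw [extend_of_mem c i.2, zero_mul]
      rw [← this, ← sum_notMem_add_sum_mem F, h0, add_zero]
      exact Finset.sum_congr rfl fun i _ => by rw [extend_coe]; rfl
    rw [← Finset.add_sum_erase _ _ (Finset.mem_univ j)] at h1
    have h2 : ∑ i ∈ Finset.univ.erase j, extend F c i * S.Gam i j
        = ∑ i ∈ Finset.univ.erase j, extend F c i * S.γ i j :=
      Finset.sum_congr rfl fun i hi => by
        rw [Gam, Matrix.of_apply, if_neg (Finset.ne_of_mem_erase hi)]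
    rw [h2, Gam, Matrix.of_apply, if_pos rfl] at h1
    rw [← Finset.add_sum_erase _ (fun k => S.γ j k) (Finset.mem_univ j),
      ← Finset.add_sum_erase _ (fun i => extend F c i * S.γ i j) (Finset.mem_univ j)]
    linarith
  -- Duality: b is a column of -(Γᶠ)⁻¹, nonnegative by the minimum principle, and pairing c with Γᶠ
  -- b in two ways gives cᵢ = ∑ bₖ.
  have hnn : ∀ i, 0 ≤ extend F c i := by
    intro i
    by_cases hi : i ∈ F
    · rw [extend_of_mem c hi]
    set b : {i // i ∉ F} → ℝ := (S.GamAdj F)⁻¹ *ᵥ (-Pi.single ⟨i, hi⟩ 1) with hb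
    have hGb : S.GamAdj F *ᵥ b = -Pi.single ⟨i, hi⟩ 1 := by
      rw [hb, Matrix.mulVec_mulVec, Matrix.mul_nonsing_inv _ hdet, Matrix.one_mulVec]
    have hbn := S.nonneg_of_GamAdj_mulVec_nonpos hF hγ hreach (c := b) (fun k => by
      rw [hGb, Pi.neg_apply, neg_nonpos]
      exact (Pi.single_nonneg.2 zero_le_one : (0 : {i // i ∉ F} → ℝ) ≤ _) k)
    have h1 : c ⬝ᵥ (S.GamAdj F *ᵥ b) = (fun _ => -1) ⬝ᵥ b := by
      rw [Matrix.dotProduct_mulVec, hcG]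
    rw [hGb, dotProduct_neg, dotProduct_single, mul_one] at h1
    have h2 : (fun _ => (-1 : ℝ)) ⬝ᵥ b = -∑ k, b k := by
      simp [dotProduct]
    have h3 : 0 ≤ ∑ k, b k := Finset.sum_nonneg fun k _ => hbn k
    have : extend F c i = c ⟨i, hi⟩ := extend_coe F c ⟨i, hi⟩
    linarith
  refine ⟨extend F c, hnn, fun i hi => (hnn i).lt_of_ne' fun h0 => ?_,
    fun i hi => extend_of_mem c hi, heq⟩
  have h1 := heq i hi
  have h2 : 0 ≤ ∑ k, extend F c k * S.γ k i :=
    Finset.sum_nonneg fun k _ => mul_nonneg (hnn k) (S.γ_nonneg k i)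
  rw [h0] at h1
  linarith

end

/-- Coercivity of the Laplacian with respect to the weights `d`. -/
lemma sum_weight_lap_le {F : Finset (Fin n)} {d : Fin n → ℝ} (hd : ∀ i, 0 ≤ d i)
    (heq : ∀ j, j ∉ F → d j * ∑ k, S.γ j k - ∑ i, d i * S.γ i j = 1) {w : Fin n → ℝ}
    (hw : ∀ i ∈ F, w i = 0) :
    2 * ∑ i, d i * (w i * S.lap w i) ≤ -∑ i, w i ^ 2 := by
  -- Uses 2wᵢ(wⱼ - wᵢ) = wⱼ² - wᵢ² - (wᵢ - wⱼ)² and drops the last square. Exchanging the sums then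
  -- makes `heq` appear as the coefficient of each wⱼ².
  have h1 : 2 * ∑ i, d i * (w i * S.lap w i)
      ≤ ∑ i, ∑ j, (d i * S.γ i j * w j ^ 2 - d i * S.γ i j * w i ^ 2) := by
    rw [Finset.mul_sum]
    refine Finset.sum_le_sum fun i _ => ?_
    rw [lap, Finset.mul_sum, Finset.mul_sum, Finset.mul_sum]
    refine Finset.sum_le_sum fun j _ => ?_
    have := mul_nonneg (mul_nonneg (hd i) (S.γ_nonneg i j)) (sq_nonneg (w i - w j))
    nlinarith
  refine h1.trans (le_of_eq ?_)
  simp_rw [Finset.sum_sub_distrib]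
  rw [Finset.sum_comm, ← Finset.sum_sub_distrib, ← Finset.sum_neg_distrib]
  refine Finset.sum_congr rfl fun j _ => ?_
  by_cases hj : j ∈ F
  · simp [hw j hj]
  · rw [← Finset.sum_mul, ← Finset.sum_mul, ← Finset.mul_sum]
    linear_combination (-(w j ^ 2)) * heq j hj

lemma lap_sq_le (w : Fin n → ℝ) (i : Fin n) :
    S.lap w i ^ 2 ≤ (∑ j, S.γ i j ^ 2) * (2 + 2 * n) * ∑ j, w j ^ 2 := by
  have h1 : S.lap w i ^ 2 ≤ (∑ j, S.γ i j ^ 2) * ∑ j, (w j - w i) ^ 2 :=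
    Finset.sum_mul_sq_le_sq_mul_sq _ _ _
  have h2 : ∑ j, (w j - w i) ^ 2 ≤ (2 + 2 * n) * ∑ j, w j ^ 2 := by
    have hi : w i ^ 2 ≤ ∑ j, w j ^ 2 :=
      Finset.single_le_sum (f := fun j => w j ^ 2) (fun j _ => sq_nonneg _) (Finset.mem_univ i)
    calc ∑ j, (w j - w i) ^ 2 ≤ ∑ j, (2 * w j ^ 2 + 2 * w i ^ 2) :=
          Finset.sum_le_sum fun j _ => by nlinarith [sq_nonneg (w j + w i)]
      _ = 2 * ∑ j, w j ^ 2 + n * (2 * w i ^ 2) := by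
          rw [Finset.sum_add_distrib, ← Finset.mul_sum]; simp
      _ ≤ _ := by
          have : (n : ℝ) * w i ^ 2 ≤ n * ∑ j, w j ^ 2 := by gcongr
          linarith
  rw [mul_assoc]
  exact h1.trans (mul_le_mul_of_nonneg_left h2 (Finset.sum_nonneg fun j _ => sq_nonneg _))

/-! ### Equilibrium and error recursion. -/

lemma z_eq_rho (i : Fin n) (θ : Fin 2 → ℝ) (ξ : ℝ) :
    S.z i θ ξ = S.rho i θ 0 * ξ + S.rho i θ 1 := by
  simp [z, y, rho, Matrix.mulVec, dotProduct, Fin.sum_univ_two]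
  ring

/-- The fixed point of the averaged recursion, in calibration parameters. -/
lemma exists_equilibrium {F : Finset (Fin n)} (hα : ∀ i, i ∉ F → S.α i ≠ 0)
    (hu : IsUnit (S.GamAdj F ⊗ₖ (1 : Matrix (Fin 2) (Fin 2) ℝ))) (θf : Fin n → Fin 2 → ℝ) :
    ∃ θs : Fin n → Fin 2 → ℝ, (∀ i ∈ F, θs i = θf i) ∧
      (∀ p : {i // i ∉ F} × Fin 2, S.rho p.1 (θs p.1) p.2 = S.rhoLim F θf p) ∧
      ∀ i, i ∉ F → ∀ ξ, S.lap (fun j => S.z j (θs j) ξ) i = 0 := by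
  classical
  set R := S.rhoLim F θf with hR
  -- Off `F` this inverts the triangular map `rho`, which needs a nonzero gain.
  let θs : Fin n → Fin 2 → ℝ := fun i => if h : i ∈ F then θf i else
    ![R (⟨i, h⟩, 0) / S.α i, R (⟨i, h⟩, 1) - R (⟨i, h⟩, 0) / S.α i * S.β i]
  have hθF : ∀ i ∈ F, θs i = θf i := fun i hi => by simp [θs, hi]
  have hρ : ∀ p : {i // i ∉ F} × Fin 2, S.rho p.1 (θs p.1) p.2 = R p := by
    rintro ⟨⟨i, hi⟩, k⟩
    have := hα i hi
    fin_cases k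
    · simp [θs, hi, rho, Matrix.mulVec, dotProduct, Fin.sum_univ_two]
      field_simp
    · simp [θs, hi, rho, Matrix.mulVec, dotProduct, Fin.sum_univ_two]
      field_simp
      ring
  refine ⟨θs, hθF, hρ, fun i hi ξ => ?_⟩
  have hGR : (S.GamAdj F ⊗ₖ (1 : Matrix (Fin 2) (Fin 2) ℝ)) *ᵥ R
      = -((S.GamFixed F ⊗ₖ (1 : Matrix (Fin 2) (Fin 2) ℝ)) *ᵥ S.rhoFixed F θf) := by
    rw [hR, rhoLim, Matrix.mulVec_neg, Matrix.mulVec_mulVec,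
      Matrix.mul_nonsing_inv _ ((Matrix.isUnit_iff_isUnit_det _).1 hu), Matrix.one_mulVec]
  have hcoord : ∀ k, S.lap (fun j => S.rho j (θs j) k) i = 0 := by
    intro k
    have h1 := congrFun hGR (⟨i, hi⟩, k)
    have hA : ∀ (m : Type) [Fintype m] (M : Matrix {i // i ∉ F} m ℝ) (v : m × Fin 2 → ℝ)
        (a : {i // i ∉ F}),
        ((M ⊗ₖ (1 : Matrix (Fin 2) (Fin 2) ℝ)) *ᵥ v) (a, k) = (M *ᵥ fun b => v (b, k)) a := by
      intro m _ M v a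
      simp [Matrix.mulVec, dotProduct, Fintype.sum_prod_type, Matrix.one_apply]
    rw [Pi.neg_apply, hA, hA] at h1
    rw [S.lap_eq_mulVec_add F _ ⟨i, hi⟩]
    have h2 : (fun j : {i // i ∉ F} => S.rho j (θs j) k) = fun j => R (j, k) :=
      funext fun j => hρ (j, k)
    have h3 : (fun j : {i // i ∈ F} => S.rho j (θs j) k) = fun j => S.rhoFixed F θf (j, k) :=
      funext fun j => by rw [rhoFixed, hθF j j.2]
    rw [h2, h3, h1, neg_add_cancel]
  -- The Laplacian of the outputs is affine in ξ and both coefficients vanish, hence an equilibrium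
  -- for every ξ.
  have : S.lap (fun j => S.z j (θs j) ξ) i
      = S.lap (fun j => S.rho j (θs j) 0) i * ξ + S.lap (fun j => S.rho j (θs j) 1) i := by
    simp only [lap, z_eq_rho, Finset.sum_mul, ← Finset.sum_add_distrib]
    exact Finset.sum_congr rfl fun j _ => by ring
  rw [this, hcoord, hcoord]
  ring

/-- One step of the calibration recursion when the signal has the value `ξ`. -/
def step (F : Finset (Fin n)) (δ : ℝ) (θ : Fin n → Fin 2 → ℝ) (ξ : ℝ) : Fin n → Fin 2 → ℝ :=
  fun i => if i ∈ F then θ i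
    else θ i + (δ * S.lap (fun j => S.z j (θ j) ξ) i) • ![S.y i ξ, 1]

lemma theta_succ (F : Finset (Fin n)) (θf : Fin n → Fin 2 → ℝ) (δ : ℝ) (x : ℕ → ℝ) (t : ℕ) :
    S.theta F θf δ x (t + 1) = S.step F δ (S.theta F θf δ x t) (x t) := by
  funext i
  simp only [theta, step]
  split_ifs
  · rfl
  · rw [← Finset.sum_smul, S.sum_nbr_eq_lap (fun j => S.z j (S.theta F θf δ x t j) (x t)),
      smul_smul]

lemma theta_of_mem {F : Finset (Fin n)} (θf : Fin n → Fin 2 → ℝ) (δ : ℝ) (x : ℕ → ℝ) (t : ℕ)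
    {i : Fin n} (hi : i ∈ F) : S.theta F θf δ x t i = θf i := by
  induction t with
  | zero => simp [theta, hi]
  | succ t ih => rw [theta_succ, step, if_pos hi, ih]

/-- Linearity of the step in the state; no additive noise remains in the error. -/
lemma step_sub {F : Finset (Fin n)} (δ : ℝ) (θ θs : Fin n → Fin 2 → ℝ) (ξ : ℝ)
    (hθs : ∀ i, i ∉ F → S.lap (fun j => S.z j (θs j) ξ) i = 0) :
    S.step F δ θ ξ - θs = S.step F δ (θ - θs) ξ := by
  funext i
  simp only [Pi.sub_apply, step]
  split_ifs with hi
  · rfl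
  · have : S.lap (fun j => S.z j (θ j - θs j) ξ) i = S.lap (fun j => S.z j (θ j) ξ) i := by
      rw [← sub_zero (S.lap (fun j => S.z j (θ j) ξ) i), ← hθs i hi, lap, lap, lap,
        ← Finset.sum_sub_distrib]
      exact Finset.sum_congr rfl fun j _ => by simp only [z, Pi.sub_apply]; ring
    rw [this]
    abel

/-! ### One-step energy estimates. -/

/-- The weighted squared norm of a family of calibration parameters. -/
def energy (d : Fin n → ℝ) (e : Fin n → Fin 2 → ℝ) : ℝ := ∑ i, d i * (e i 0 ^ 2 + e i 1 ^ 2)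

/-- The squared norm of the outputs of the sensors. -/
def outSq (e : Fin n → Fin 2 → ℝ) (ξ : ℝ) : ℝ := ∑ i, S.z i (e i) ξ ^ 2

lemma energy_nonneg {d : Fin n → ℝ} (hd : ∀ i, 0 ≤ d i) (e : Fin n → Fin 2 → ℝ) :
    0 ≤ energy d e :=
  Finset.sum_nonneg fun i _ => mul_nonneg (hd i) (by positivity)

lemma outSq_nonneg (e : Fin n → Fin 2 → ℝ) (ξ : ℝ) : 0 ≤ S.outSq e ξ :=
  Finset.sum_nonneg fun _ _ => sq_nonneg _

lemma y_sq_add_one_le (i : Fin n) (ξ : ℝ) :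
    S.y i ξ ^ 2 + 1 ≤ (2 * S.α i ^ 2 + 2 * S.β i ^ 2 + 1) * (1 + ξ ^ 2) := by
  rw [y]
  nlinarith [sq_nonneg (S.α i * ξ - S.β i), sq_nonneg (S.β i * ξ), sq_nonneg (S.α i),
    sq_nonneg ξ, mul_pow (S.α i) ξ 2]

/-- One step decreases the energy up to a second order term in the step size. -/
lemma exists_energy_step_le {F : Finset (Fin n)} {d : Fin n → ℝ} (hd : ∀ i, 0 ≤ d i)
    (hdpos : ∀ i, i ∉ F → 0 < d i) (hdF : ∀ i ∈ F, d i = 0)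
    (heq : ∀ j, j ∉ F → d j * ∑ k, S.γ j k - ∑ i, d i * S.γ i j = 1) :
    ∃ C : ℝ, 0 < C ∧ ∀ e : Fin n → Fin 2 → ℝ, (∀ i ∈ F, e i = 0) → ∀ ξ : ℝ,
      S.outSq e ξ ≤ C * (1 + ξ ^ 2) * energy d e ∧
      ∀ δ : ℝ, 0 ≤ δ → energy d (S.step F δ e ξ) ≤
        energy d e - δ * S.outSq e ξ + δ ^ 2 * (C * (1 + ξ ^ 2)) * S.outSq e ξ := by
  set a : Fin n → ℝ := fun i => 2 * S.α i ^ 2 + 2 * S.β i ^ 2 + 1 with ha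
  have hapos : ∀ i, 0 < a i := fun i => by positivity
  set b : Fin n → ℝ := fun i => (∑ j, S.γ i j ^ 2) * (2 + 2 * n) with hb
  have hbnn : ∀ i, 0 ≤ b i := fun i => by positivity
  -- Summands over `F` vanish because `0⁻¹ = 0`. `C₁` bounds the output by the energy, `C₂` the
  -- second order term.
  set C₁ := ∑ i, a i * (d i)⁻¹ with hC₁
  set C₂ := ∑ i, d i * b i * a i with hC₂
  have hC₁i : ∀ i, a i * (d i)⁻¹ ≤ C₁ := fun i =>
    Finset.single_le_sum (f := fun i => a i * (d i)⁻¹)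
      (fun i _ => mul_nonneg (hapos i).le (inv_nonneg.2 (hd i))) (Finset.mem_univ i)
  have hC₁nn : 0 ≤ C₁ := Finset.sum_nonneg fun i _ =>
    mul_nonneg (hapos i).le (inv_nonneg.2 (hd i))
  have hC₂nn : 0 ≤ C₂ := Finset.sum_nonneg fun i _ =>
    mul_nonneg (mul_nonneg (hd i) (hbnn i)) (hapos i).le
  refine ⟨C₁ + C₂ + 1, by positivity, fun e he ξ => ?_⟩
  have hu : 0 < 1 + ξ ^ 2 := by positivity
  have hV := energy_nonneg hd e
  have hW := S.outSq_nonneg e ξ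
  have hzF : ∀ i ∈ F, S.z i (e i) ξ = 0 := fun i hi => by simp [z, he i hi]
  constructor
  · have : S.outSq e ξ ≤ C₁ * (1 + ξ ^ 2) * energy d e := by
      rw [outSq, energy, Finset.mul_sum]
      refine Finset.sum_le_sum fun i _ => ?_
      by_cases hi : i ∈ F
      · simp [hzF i hi, hdF i hi]
      · have hdi := hdpos i hi
        have h1 : S.z i (e i) ξ ^ 2 ≤ (S.y i ξ ^ 2 + 1) * (e i 0 ^ 2 + e i 1 ^ 2) := by
          rw [z]
          nlinarith [sq_nonneg (e i 0 - e i 1 * S.y i ξ)]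
        have hE : 0 ≤ e i 0 ^ 2 + e i 1 ^ 2 := by positivity
        have h2 : a i ≤ C₁ * d i := by
          rw [← div_le_iff₀ hdi, div_eq_mul_inv]
          exact hC₁i i
        calc S.z i (e i) ξ ^ 2 ≤ (S.y i ξ ^ 2 + 1) * (e i 0 ^ 2 + e i 1 ^ 2) := h1
          _ ≤ (a i * (1 + ξ ^ 2)) * (e i 0 ^ 2 + e i 1 ^ 2) :=
              mul_le_mul_of_nonneg_right (S.y_sq_add_one_le i ξ) hE
          _ ≤ ((C₁ * d i) * (1 + ξ ^ 2)) * (e i 0 ^ 2 + e i 1 ^ 2) := by gcongr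
          _ = _ := by ring
    refine this.trans ?_
    gcongr
    linarith
  · intro δ hδ
    set w : Fin n → ℝ := fun j => S.z j (e j) ξ with hw
    -- Exact expansion of the square: the update direction (y, 1) has inner product wᵢ with eᵢ.
    have hstep : energy d (S.step F δ e ξ) = energy d e
        + δ * (2 * ∑ i, d i * (w i * S.lap w i))
        + δ ^ 2 * ∑ i, d i * (S.lap w i ^ 2 * (S.y i ξ ^ 2 + 1)) := by
      simp only [energy, Finset.mul_sum, ← Finset.sum_add_distrib]
      refine Finset.sum_congr rfl fun i _ => ?_
      by_cases hi : i ∈ F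
      · simp [hdF i hi]
      · have hwi : w i = e i 0 * S.y i ξ + e i 1 := rfl
        simp only [step, if_neg hi, Pi.add_apply, Pi.smul_apply, smul_eq_mul,
          Matrix.cons_val_zero, Matrix.cons_val_one, hwi]
        ring
    have h1 := S.sum_weight_lap_le hd heq (w := w) hzF
    have hWw : ∑ i, w i ^ 2 = S.outSq e ξ := rfl
    rw [hWw] at h1
    have h2 : ∑ i, d i * (S.lap w i ^ 2 * (S.y i ξ ^ 2 + 1))
        ≤ C₂ * (1 + ξ ^ 2) * S.outSq e ξ := by
      rw [hC₂, Finset.sum_mul, Finset.sum_mul]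
      refine Finset.sum_le_sum fun i _ => ?_
      calc d i * (S.lap w i ^ 2 * (S.y i ξ ^ 2 + 1))
          ≤ d i * ((b i * S.outSq e ξ) * (a i * (1 + ξ ^ 2))) :=
            mul_le_mul_of_nonneg_left (mul_le_mul (S.lap_sq_le w i) (S.y_sq_add_one_le i ξ)
              (by positivity) (mul_nonneg (hbnn i) hW)) (hd i)
        _ = _ := by ring
    rw [hstep]
    have h3 := mul_le_mul_of_nonneg_left h1 hδ
    have h4 := mul_le_mul_of_nonneg_left h2 (sq_nonneg δ)
    have h5 : 0 ≤ δ ^ 2 * ((C₁ + 1) * (1 + ξ ^ 2)) * S.outSq e ξ := by positivity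
    linarith

/-- The expected squared output dominates the energy when the signal has positive variance. -/
lemma exists_energy_le_sum (F : Finset (Fin n)) {d : Fin n → ℝ} (hd : ∀ i, 0 ≤ d i)
    (hα : ∀ i, i ∉ F → S.α i ≠ 0) (hdF : ∀ i ∈ F, d i = 0) {m s : ℝ}
    (hvar : 0 < s ^ 2 - m ^ 2) :
    ∃ σ : ℝ, 0 < σ ∧ ∀ e : Fin n → Fin 2 → ℝ, σ * energy d e ≤
      ∑ i, (S.rho i (e i) 0 ^ 2 * s ^ 2 + 2 * S.rho i (e i) 0 * S.rho i (e i) 1 * m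
        + S.rho i (e i) 1 ^ 2) := by
  set v := s ^ 2 - m ^ 2 with hv
  -- Obtained by writing the parameters as p/α and (pm+q) - p(m+β/α), to be compared with p²v +
  -- (pm+q)². On `F` the gain may be zero, but there d is zero too.
  set K : Fin n → ℝ := fun i => (1 / S.α i ^ 2 + 2 * (m + S.β i / S.α i) ^ 2) / v + 2 with hK
  have hKnn : ∀ i, 0 ≤ K i := fun i => by positivity
  set c := 1 + ∑ i, d i * K i with hc
  have hdK : ∀ i, 0 ≤ d i * K i := fun i => mul_nonneg (hd i) (hKnn i)
  have hci : ∀ i, d i * K i ≤ c := fun i => by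
    have := Finset.single_le_sum (f := fun i => d i * K i) (fun i _ => hdK i)
      (Finset.mem_univ i)
    linarith
  have hcpos : 0 < c := add_pos_of_pos_of_nonneg one_pos (Finset.sum_nonneg fun i _ => hdK i)
  refine ⟨c⁻¹, inv_pos.2 hcpos, fun e => ?_⟩
  rw [inv_mul_le_iff₀ hcpos, energy, Finset.mul_sum]
  refine Finset.sum_le_sum fun i _ => ?_
  set p := S.rho i (e i) 0 with hp
  set q := S.rho i (e i) 1 with hq
  have hT : p ^ 2 * s ^ 2 + 2 * p * q * m + q ^ 2 = p ^ 2 * v + (p * m + q) ^ 2 := by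
    rw [hv]; ring
  rw [hT]
  have hTnn : 0 ≤ p ^ 2 * v + (p * m + q) ^ 2 := by positivity
  by_cases hi : i ∈ F
  · rw [hdF i hi, zero_mul]
    positivity
  have hαi := hα i hi
  have hp' : p = S.α i * e i 0 := by
    simp [hp, rho, Matrix.mulVec, dotProduct, Fin.sum_univ_two]
  have hq' : q = S.β i * e i 0 + e i 1 := by
    simp [hq, rho, Matrix.mulVec, dotProduct, Fin.sum_univ_two]
  have h0 : e i 0 ^ 2 = p ^ 2 / S.α i ^ 2 := by
    rw [hp']; field_simp
  have h1 : e i 1 = (p * m + q) - p * (m + S.β i / S.α i) := by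
    rw [hp', hq']; field_simp; ring
  have hmain : e i 0 ^ 2 + e i 1 ^ 2 ≤ K i * (p ^ 2 * v + (p * m + q) ^ 2) := by
    set B := 1 / S.α i ^ 2 + 2 * (m + S.β i / S.α i) ^ 2 with hB
    have hBnn : 0 ≤ B := by positivity
    have h2 : e i 0 ^ 2 + e i 1 ^ 2 ≤ B * p ^ 2 + 2 * (p * m + q) ^ 2 := by
      rw [h0, h1, hB]
      have : p ^ 2 / S.α i ^ 2 = 1 / S.α i ^ 2 * p ^ 2 := by ring
      rw [this]
      nlinarith [sq_nonneg ((p * m + q) + p * (m + S.β i / S.α i))]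
    have h3 : K i * (p ^ 2 * v + (p * m + q) ^ 2) = B * p ^ 2 + B / v * (p * m + q) ^ 2
        + 2 * (p ^ 2 * v) + 2 * (p * m + q) ^ 2 := by
      simp only [hK, ← hB]
      field_simp
      ring
    have h4 : 0 ≤ B / v * (p * m + q) ^ 2 := by positivity
    have h5 : 0 ≤ 2 * (p ^ 2 * v) := by positivity
    linarith
  calc d i * (e i 0 ^ 2 + e i 1 ^ 2) ≤ d i * (K i * (p ^ 2 * v + (p * m + q) ^ 2)) :=
        mul_le_mul_of_nonneg_left hmain (hd i)
    _ = d i * K i * (p ^ 2 * v + (p * m + q) ^ 2) := by ring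
    _ ≤ _ := mul_le_mul_of_nonneg_right (hci i) hTnn

end SensorNetwork

/-! ### Contraction in mean over one signal value. -/

section Contraction

variable {ν : Measure ℝ} [IsProbabilityMeasure ν]

lemma integrable_one_add_sq (hsq : Integrable (fun ξ : ℝ => ξ ^ 2) ν) :
    Integrable (fun ξ : ℝ => 1 + ξ ^ 2) ν := (integrable_const 1).add hsq

lemma integral_sub_add {f g : ℝ → ℝ} (hf : Integrable f ν) (hg : Integrable g ν) (c a b : ℝ) :
    Integrable (fun ξ => c - a * f ξ + b * g ξ) ν ∧
      ∫ ξ, (c - a * f ξ + b * g ξ) ∂ν = c - a * ∫ ξ, f ξ ∂ν + b * ∫ ξ, g ξ ∂ν := by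
  have h1 : Integrable (fun ξ => c - a * f ξ) ν := (integrable_const c).sub (hf.const_mul a)
  refine ⟨h1.add (hg.const_mul b), ?_⟩
  rw [integral_add h1 (hg.const_mul b), integral_sub (integrable_const c) (hf.const_mul a),
    integral_const_mul, integral_const_mul]
  simp

/-- The tails of an integrable second moment are uniformly small. -/
lemma exists_tail_le (hsq : Integrable (fun ξ : ℝ => ξ ^ 2) ν) {ε : ℝ} (hε : 0 < ε) :
    ∃ A : ℕ, ∫ ξ in {ξ : ℝ | (A : ℝ) < 1 + ξ ^ 2}, (1 + ξ ^ 2) ∂ν ≤ ε := by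
  have hmeas : ∀ A : ℕ, MeasurableSet {ξ : ℝ | (A : ℝ) < 1 + ξ ^ 2} := fun A =>
    measurableSet_lt measurable_const (by fun_prop)
  have hanti : Antitone fun A : ℕ => {ξ : ℝ | (A : ℝ) < 1 + ξ ^ 2} := fun A B hAB ξ
      (hξ : (B : ℝ) < 1 + ξ ^ 2) => lt_of_le_of_lt (Nat.cast_le.2 hAB) hξ
  have h := tendsto_setIntegral_of_antitone hmeas hanti
    ⟨0, (integrable_one_add_sq hsq).integrableOn⟩
  have hempty : ⋂ A : ℕ, {ξ : ℝ | (A : ℝ) < 1 + ξ ^ 2} = ∅ := by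
    refine Set.eq_empty_iff_forall_notMem.2 fun ξ hξ => ?_
    obtain ⟨A, hA⟩ := exists_nat_gt (1 + ξ ^ 2)
    exact lt_asymm hA (Set.mem_iInter.1 hξ A)
  rw [hempty, setIntegral_empty] at h
  exact (h.eventually (gt_mem_nhds hε)).exists.imp fun _ hA => hA.le

/-- Here u stands for 1+ξ². For small u the first order decrease absorbs half of itself and the mean
inequality √V√V' ≤ (V+V')/2 finishes. For large u the crude bound √V' ≤ (1+δCu)√V is used; it is
linear in u, so second moments suffice. -/
lemma sqrt_mul_sqrt_le {V V' W C u δ : ℝ} (hV : 0 ≤ V) (hV' : 0 ≤ V') (hW : 0 ≤ W)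
    (hC : 0 < C) (hu : 0 ≤ u) (hδ : 0 < δ) (hWV : W ≤ C * u * V)
    (h : V' ≤ V - δ * W + δ ^ 2 * (C * u) * W) :
    √V * √V' ≤ V - δ / 4 * W + 2 * δ * C * V * (if 1 < 2 * δ * C * u then u else 0) := by
  have hsV := Real.sq_sqrt hV
  have hsV' := Real.sq_sqrt hV'
  split_ifs with hbig
  · have h1 : V' ≤ (1 + δ * C * u) ^ 2 * V := by
      have h2 : δ ^ 2 * (C * u) * W ≤ δ ^ 2 * (C * u) * (C * u * V) := by gcongr
      have h3 : 0 ≤ δ * W := by positivity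
      have h4 : 0 ≤ δ * C * u * V := by positivity
      nlinarith
    have h2 : √V' ≤ (1 + δ * C * u) * √V := by
      rw [← Real.sqrt_sq (show 0 ≤ 1 + δ * C * u by positivity), ← Real.sqrt_mul (by positivity)]
      exact Real.sqrt_le_sqrt h1
    have h3 : √V * √V' ≤ (1 + δ * C * u) * V := by
      calc √V * √V' ≤ √V * ((1 + δ * C * u) * √V) := by gcongr
        _ = (1 + δ * C * u) * √V ^ 2 := by ring
        _ = _ := by rw [hsV]
    have h4 : δ * W ≤ δ * (C * u * V) := by gcongr
    have h5 : 0 ≤ δ * (C * u * V) := by positivity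
    linarith
  · have h1 : δ ^ 2 * (C * u) * W ≤ δ / 2 * W := by
      refine mul_le_mul_of_nonneg_right ?_ hW
      have := mul_le_mul_of_nonneg_left (not_lt.1 hbig) hδ.le
      linarith
    have h2 := two_mul_le_add_sq (√V) (√V')
    linarith

/-- The square root of a Lyapunov function contracts in mean: only second moments of the
signal are needed, and the step size is uniform in the state. -/
lemma exists_sqrt_contraction (hsq : Integrable (fun ξ : ℝ => ξ ^ 2) ν) {C σ : ℝ} (hC : 0 < C)
    (hσ : 0 < σ) :
    ∃ δ₀ : ℝ, 0 < δ₀ ∧ ∀ δ, 0 < δ → δ ≤ δ₀ → 0 ≤ 1 - δ * σ / 8 ∧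
      ∀ (V : ℝ) (V' W : ℝ → ℝ), 0 ≤ V → (∀ ξ, 0 ≤ V' ξ) → (∀ ξ, 0 ≤ W ξ) →
      Integrable W ν → σ * V ≤ ∫ ξ, W ξ ∂ν → (∀ ξ, W ξ ≤ C * (1 + ξ ^ 2) * V) →
      (∀ ξ, V' ξ ≤ V - δ * W ξ + δ ^ 2 * (C * (1 + ξ ^ 2)) * W ξ) →
      ∫⁻ ξ, ENNReal.ofReal (√(V' ξ)) ∂ν
        ≤ ENNReal.ofReal (1 - δ * σ / 8) * ENNReal.ofReal (√V) := by
  obtain ⟨A, hA⟩ := exists_tail_le hsq (ε := σ / (16 * C)) (by positivity)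
  -- The first bound forces large signals into the tail beyond A, so their cost is at most δσV/8
  -- against a gain of δσV/4; the second keeps the factor nonnegative.
  refine ⟨min (1 / (2 * C * (A + 1))) (4 / σ), by positivity, fun δ hδ hδ₀ => ?_⟩
  have hδ1 : δ * (2 * C * (A + 1)) ≤ 1 :=
    (le_div_iff₀ (by positivity)).1 (hδ₀.trans (min_le_left _ _))
  have hδ2 : δ * σ ≤ 4 := (le_div_iff₀ hσ).1 (hδ₀.trans (min_le_right _ _))
  have hq : 0 ≤ 1 - δ * σ / 8 := by linarith
  refine ⟨hq, fun V V' W hV hV' hW hWi hσV hWV hstep => ?_⟩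
  -- Zero energy is separated because √V is cancelled at the end.
  rcases hV.eq_or_lt with rfl | hVpos
  · have : ∀ ξ, V' ξ = 0 := fun ξ => le_antisymm (by
      have h1 : W ξ = 0 := le_antisymm (by simpa using hWV ξ) (hW ξ)
      simpa [h1] using hstep ξ) (hV' ξ)
    simp [this]
  set g : ℝ → ℝ := fun ξ => if 1 < 2 * δ * C * (1 + ξ ^ 2) then 1 + ξ ^ 2 else 0 with hg
  set G : Set ℝ := {ξ : ℝ | 1 < 2 * δ * C * (1 + ξ ^ 2)} with hG
  have hGm : MeasurableSet G := measurableSet_lt measurable_const (by fun_prop)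
  have hgG : g = G.indicator fun ξ => 1 + ξ ^ 2 := by
    funext ξ
    simp [hg, hG, Set.indicator_apply]
  have hui := integrable_one_add_sq hsq
  have hgi : Integrable g ν := hgG ▸ hui.indicator hGm
  have hgint : ∫ ξ, g ξ ∂ν ≤ σ / (16 * C) := by
    rw [hgG, integral_indicator hGm]
    refine le_trans (setIntegral_mono_set hui.integrableOn
      (Eventually.of_forall fun ξ => by positivity) ?_) hA
    refine (show G ⊆ _ from fun ξ hξ => ?_).eventuallyLE
    have hξ' : 1 < 2 * δ * C * (1 + ξ ^ 2) := hξ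
    have : δ * (2 * C * (A + 1)) < δ * (2 * C * (1 + ξ ^ 2)) := by linarith
    have h2 := lt_of_mul_lt_mul_left (lt_of_mul_lt_mul_left this hδ.le) (by positivity)
    change (A : ℝ) < 1 + ξ ^ 2
    linarith
  have hpt : ∀ ξ, √V * √(V' ξ) ≤ V - δ / 4 * W ξ + 2 * δ * C * V * g ξ := fun ξ =>
    sqrt_mul_sqrt_le hV (hV' ξ) (hW ξ) hC (by positivity) hδ (hWV ξ) (hstep ξ)
  obtain ⟨hRi, hReq⟩ := integral_sub_add hWi hgi V (δ / 4) (2 * δ * C * V)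
  have hRint : ∫ ξ, (V - δ / 4 * W ξ + 2 * δ * C * V * g ξ) ∂ν ≤ (1 - δ * σ / 8) * V := by
    rw [hReq]
    have h1 := mul_le_mul_of_nonneg_left hσV (show 0 ≤ δ / 4 by positivity)
    have h2 := mul_le_mul_of_nonneg_left hgint (show 0 ≤ 2 * δ * C * V by positivity)
    have h3 : 2 * δ * C * V * (σ / (16 * C)) = δ * σ / 8 * V := by
      field_simp
      ring
    linarith
  have hs : 0 < √V := Real.sqrt_pos.2 hVpos
  have hmul : ENNReal.ofReal √V * ∫⁻ ξ, ENNReal.ofReal (√(V' ξ)) ∂ν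
      ≤ ENNReal.ofReal √V * (ENNReal.ofReal (1 - δ * σ / 8) * ENNReal.ofReal (√V)) := by
    rw [← lintegral_const_mul' _ _ ENNReal.ofReal_ne_top]
    calc ∫⁻ ξ, ENNReal.ofReal √V * ENNReal.ofReal (√(V' ξ)) ∂ν
        ≤ ∫⁻ ξ, ENNReal.ofReal (V - δ / 4 * W ξ + 2 * δ * C * V * g ξ) ∂ν := by
          refine lintegral_mono fun ξ => ?_
          rw [← ENNReal.ofReal_mul hs.le]
          exact ENNReal.ofReal_le_ofReal (hpt ξ)
      _ = ENNReal.ofReal (∫ ξ, (V - δ / 4 * W ξ + 2 * δ * C * V * g ξ) ∂ν) :=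
          (ofReal_integral_eq_lintegral_ofReal hRi (Eventually.of_forall fun ξ =>
            (mul_nonneg hs.le (Real.sqrt_nonneg _)).trans (hpt ξ))).symm
      _ ≤ ENNReal.ofReal ((1 - δ * σ / 8) * V) := ENNReal.ofReal_le_ofReal hRint
      _ = _ := by
          rw [← ENNReal.ofReal_mul hq, ← ENNReal.ofReal_mul hs.le]
          congr 1
          nth_rw 1 [← Real.mul_self_sqrt hV]
          ring
  exact (ENNReal.mul_le_mul_iff_right (by simpa using hs) ENNReal.ofReal_ne_top).1 hmul

/-- A Lyapunov function contracts in mean when the signal has a fourth moment. -/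
lemma exists_contraction (hsq : Integrable (fun ξ : ℝ => ξ ^ 2) ν)
    (hfour : Integrable (fun ξ : ℝ => ξ ^ 4) ν) {C σ : ℝ} (hC : 0 < C) (hσ : 0 < σ) :
    ∃ δ₀ : ℝ, 0 < δ₀ ∧ ∀ δ, 0 < δ → δ ≤ δ₀ → 0 ≤ 1 - δ * σ / 2 ∧
      ∀ (V : ℝ) (V' W : ℝ → ℝ), 0 ≤ V → (∀ ξ, 0 ≤ V' ξ) →
      Integrable W ν → σ * V ≤ ∫ ξ, W ξ ∂ν → (∀ ξ, W ξ ≤ C * (1 + ξ ^ 2) * V) →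
      (∀ ξ, V' ξ ≤ V - δ * W ξ + δ ^ 2 * (C * (1 + ξ ^ 2)) * W ξ) →
      ∫⁻ ξ, ENNReal.ofReal (V' ξ) ∂ν
        ≤ ENNReal.ofReal (1 - δ * σ / 2) * ENNReal.ofReal V := by
  have hui : Integrable (fun ξ : ℝ => (1 + ξ ^ 2) ^ 2) ν :=
    (((integrable_const 1).add (hsq.const_mul 2)).add hfour).congr
      (Eventually.of_forall fun ξ => by simp only [Pi.add_apply]; ring)
  set M := ∫ ξ, (1 + ξ ^ 2) ^ 2 ∂ν with hM
  have hMnn : 0 ≤ M := integral_nonneg fun ξ => by positivity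
  -- The first bound makes the second order term δ²C²MV at most half of the gain δσV.
  refine ⟨min (σ / (2 * (C ^ 2 * M + 1))) (2 / σ), by positivity, fun δ hδ hδ₀ => ?_⟩
  have hδ1 : δ * (2 * (C ^ 2 * M + 1)) ≤ σ :=
    (le_div_iff₀ (by positivity)).1 (hδ₀.trans (min_le_left _ _))
  have hδ2 : δ * σ ≤ 2 := (le_div_iff₀ hσ).1 (hδ₀.trans (min_le_right _ _))
  have hq : 0 ≤ 1 - δ * σ / 2 := by linarith
  refine ⟨hq, fun V V' W hV hV' hWi hσV hWV hstep => ?_⟩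
  have hpt : ∀ ξ, V' ξ ≤ V - δ * W ξ + δ ^ 2 * C ^ 2 * V * (1 + ξ ^ 2) ^ 2 := by
    intro ξ
    have h1 := mul_le_mul_of_nonneg_left (hWV ξ)
      (show 0 ≤ δ ^ 2 * (C * (1 + ξ ^ 2)) by positivity)
    have h2 := hstep ξ
    linarith
  obtain ⟨hRi, hReq⟩ := integral_sub_add hWi hui V δ (δ ^ 2 * C ^ 2 * V)
  have hRint : ∫ ξ, (V - δ * W ξ + δ ^ 2 * C ^ 2 * V * (1 + ξ ^ 2) ^ 2) ∂ν
      ≤ (1 - δ * σ / 2) * V := by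
    rw [hReq]
    have h1 := mul_le_mul_of_nonneg_left hσV hδ.le
    have h2 := mul_le_mul_of_nonneg_left hδ1 (show 0 ≤ δ * V / 2 by positivity)
    have h3 : 0 ≤ δ ^ 2 * V := by positivity
    linarith
  rw [← ENNReal.ofReal_mul hq]
  calc ∫⁻ ξ, ENNReal.ofReal (V' ξ) ∂ν
      ≤ ∫⁻ ξ, ENNReal.ofReal (V - δ * W ξ + δ ^ 2 * C ^ 2 * V * (1 + ξ ^ 2) ^ 2) ∂ν :=
        lintegral_mono fun ξ => ENNReal.ofReal_le_ofReal (hpt ξ)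
    _ = ENNReal.ofReal (∫ ξ, (V - δ * W ξ + δ ^ 2 * C ^ 2 * V * (1 + ξ ^ 2) ^ 2) ∂ν) :=
        (ofReal_integral_eq_lintegral_ofReal hRi (Eventually.of_forall fun ξ =>
          (hV' ξ).trans (hpt ξ))).symm
    _ ≤ _ := ENNReal.ofReal_le_ofReal hRint

end Contraction

/-! ### Measurability, and independence of state and current signal. -/

namespace SensorNetwork

variable {n : ℕ} (S : SensorNetwork n)

lemma integrable_outSq {ν : Measure ℝ} [IsProbabilityMeasure ν]
    (h1 : Integrable (fun ξ : ℝ => ξ) ν) (hsq : Integrable (fun ξ : ℝ => ξ ^ 2) ν)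
    (e : Fin n → Fin 2 → ℝ) :
    Integrable (S.outSq e) ν ∧ ∫ ξ, S.outSq e ξ ∂ν =
      ∑ i, (S.rho i (e i) 0 ^ 2 * ∫ ξ, ξ ^ 2 ∂ν +
        2 * S.rho i (e i) 0 * S.rho i (e i) 1 * ∫ ξ, ξ ∂ν + S.rho i (e i) 1 ^ 2) := by
  have hfun : S.outSq e = fun ξ => ∑ i, (S.rho i (e i) 1 ^ 2 -
      -(2 * S.rho i (e i) 0 * S.rho i (e i) 1) * ξ + S.rho i (e i) 0 ^ 2 * ξ ^ 2) := by
    funext ξ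
    exact Finset.sum_congr rfl fun i _ => by rw [z_eq_rho]; ring
  have hi := fun i => integral_sub_add h1 hsq (S.rho i (e i) 1 ^ 2)
    (-(2 * S.rho i (e i) 0 * S.rho i (e i) 1)) (S.rho i (e i) 0 ^ 2)
  rw [hfun]
  refine ⟨integrable_finsetSum _ fun i _ => (hi i).1, ?_⟩
  rw [integral_finsetSum _ fun i _ => (hi i).1]
  exact Finset.sum_congr rfl fun i _ => by rw [(hi i).2]; ring

lemma measurable_step (F : Finset (Fin n)) (δ : ℝ) :
    Measurable fun p : (Fin n → Fin 2 → ℝ) × ℝ => S.step F δ p.1 p.2 := by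
  refine measurable_pi_lambda _ fun i => ?_
  simp only [step]
  split_ifs with hi
  · fun_prop
  · refine measurable_pi_lambda _ fun k => ?_
    simp only [lap, z, y, Pi.add_apply, Pi.smul_apply, smul_eq_mul]
    fin_cases k
    · simp only [Fin.zero_eta, Matrix.cons_val_zero]
      fun_prop
    · simp only [Fin.mk_one, Matrix.cons_val_one]
      fun_prop

lemma measurable_energy (d : Fin n → ℝ) : Measurable (energy d) := by
  unfold energy
  fun_prop

lemma measurable_theta (F : Finset (Fin n)) (θf : Fin n → Fin 2 → ℝ) (δ : ℝ) (t : ℕ) :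
    Measurable fun x : ℕ → ℝ => S.theta F θf δ x t := by
  induction t with
  | zero => exact measurable_const
  | succ t ih =>
    simp_rw [theta_succ]
    exact (S.measurable_step F δ).comp (ih.prodMk (measurable_pi_apply t))

lemma theta_congr (F : Finset (Fin n)) (θf : Fin n → Fin 2 → ℝ) (δ : ℝ) {x x' : ℕ → ℝ} {t : ℕ}
    (h : ∀ u < t, x u = x' u) : S.theta F θf δ x t = S.theta F θf δ x' t := by
  induction t with
  | zero => rfl
  | succ t ih =>
    rw [theta_succ, theta_succ, ih fun u hu => h u (hu.trans t.lt_succ_self),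
      h t t.lt_succ_self]

/-- The state at time `t` is independent of the signal at time `t`. -/
lemma indepFun_theta {Ω : Type*} [MeasurableSpace Ω] {μ : Measure Ω} {x : ℕ → Ω → ℝ}
    (hx_meas : ∀ t, Measurable (x t)) (hx_indep : iIndepFun x μ) (F : Finset (Fin n))
    (θf : Fin n → Fin 2 → ℝ) (δ : ℝ) (t : ℕ) :
    IndepFun (fun ω => S.theta F θf δ (fun u => x u ω) t) (x t) μ := by
  have h := hx_indep.indepFun_finset (Finset.range t) {t} (by simp) hx_meas
  -- Padding the past by zeros exhibits the state at time t as a measurable function of the signals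
  -- before t only.
  let ext : (Finset.range t → ℝ) → ℕ → ℝ := fun v u =>
    if hu : u ∈ Finset.range t then v ⟨u, hu⟩ else 0
  have hext : Measurable ext := measurable_pi_lambda _ fun u => by
    simp only [ext]
    split_ifs <;> fun_prop
  have h' := h.comp ((S.measurable_theta F θf δ t).comp hext)
    (measurable_pi_apply (⟨t, Finset.mem_singleton_self t⟩ : ({t} : Finset ℕ)))
  have heq : (fun ω => S.theta F θf δ (fun u => x u ω) t) =
      ((fun x => S.theta F θf δ x t) ∘ ext) ∘ fun ω (i : Finset.range t) => x i ω :=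
    funext fun ω => S.theta_congr F θf δ fun u hu => by simp [ext, hu]
  rw [heq]
  exact h'

end SensorNetwork

/-! ### From contraction in mean to convergence. -/

/-- Integration of a function of two independent variables, bounded one variable at a time. -/
lemma ProbabilityTheory.IndepFun.lintegral_le_of_forall {Ω E : Type*} [MeasurableSpace Ω]
    [MeasurableSpace E] {μ : Measure Ω} [IsProbabilityMeasure μ] {X : Ω → E} {Y : Ω → ℝ}
    (hXY : IndepFun X Y μ) (hX : Measurable X) (hY : Measurable Y) {f : E × ℝ → ENNReal}
    (hf : Measurable f) {g : E → ENNReal} {q : ENNReal} (hq : q ≠ ⊤)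
    (h : ∀ ω, ∫⁻ ξ, f (X ω, ξ) ∂(μ.map Y) ≤ q * g (X ω)) :
    ∫⁻ ω, f (X ω, Y ω) ∂μ ≤ q * ∫⁻ ω, g (X ω) ∂μ := by
  have := Measure.isProbabilityMeasure_map (μ := μ) hY.aemeasurable
  have := Measure.isProbabilityMeasure_map (μ := μ) hX.aemeasurable
  rw [← lintegral_map (f := f) (g := fun ω => (X ω, Y ω)) hf (hX.prodMk hY),
    (indepFun_iff_map_prod_eq_prod_map_map hX.aemeasurable hY.aemeasurable).1 hXY,
    lintegral_prod _ hf.aemeasurable, lintegral_map hf.lintegral_prod_right' hX,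
    ← lintegral_const_mul' _ _ hq]
  exact lintegral_mono h

lemma le_pow_mul_of_forall_succ_le {a : ℕ → ENNReal} {q : ENNReal}
    (h : ∀ t, a (t + 1) ≤ q * a t) (t : ℕ) : a t ≤ q ^ t * a 0 := by
  induction t with
  | zero => simp
  | succ t ih =>
    calc a (t + 1) ≤ q * a t := h t
      _ ≤ q * (q ^ t * a 0) := by gcongr
      _ = _ := by rw [pow_succ']; ring

/-- Nonnegative functions whose integrals decay geometrically tend to zero almost everywhere. -/
lemma ae_tendsto_zero_of_geometric {Ω : Type*} [MeasurableSpace Ω] {μ : Measure Ω}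
    {f : ℕ → Ω → ENNReal} (hf : ∀ t, Measurable (f t)) {q : ENNReal} (hq : q < 1)
    (h0 : ∫⁻ ω, f 0 ω ∂μ ≠ ⊤) (h : ∀ t, ∫⁻ ω, f (t + 1) ω ∂μ ≤ q * ∫⁻ ω, f t ω ∂μ) :
    ∀ᵐ ω ∂μ, Tendsto (fun t => f t ω) atTop (𝓝 0) := by
  -- By Tonelli the series has finite integral, so it converges almost everywhere and its terms tend
  -- to zero.
  have hsum : ∫⁻ ω, ∑' t, f t ω ∂μ ≠ ⊤ := by
    rw [lintegral_tsum fun t => (hf t).aemeasurable]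
    refine ne_top_of_le_ne_top ?_ (ENNReal.tsum_le_tsum (le_pow_mul_of_forall_succ_le h))
    rw [ENNReal.tsum_mul_right, ENNReal.tsum_geometric]
    exact ENNReal.mul_ne_top (ENNReal.inv_ne_top.2 (tsub_pos_of_lt hq).ne') h0
  filter_upwards [ae_lt_top (Measurable.tsum hf) hsum] with ω hω
  exact ENNReal.tendsto_atTop_zero_of_tsum_ne_top hω.ne

namespace SensorNetwork

variable {n : ℕ} (S : SensorNetwork n)

/-- The gains and offsets of the adjusted sensors are controlled by the energy. -/
lemma exists_rho_sq_le {F : Finset (Fin n)} {d : Fin n → ℝ} (hd : ∀ i, 0 ≤ d i)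
    (hdpos : ∀ i, i ∉ F → 0 < d i) :
    ∃ K : ℝ, ∀ e : Fin n → Fin 2 → ℝ, ∀ i, i ∉ F → ∀ k,
      S.rho i (e i) k ^ 2 ≤ K * energy d e := by
  set a : Fin n → ℝ := fun i => (S.α i ^ 2 + S.β i ^ 2 + 1) * (d i)⁻¹ with ha
  have hann : ∀ i, 0 ≤ a i := fun i => mul_nonneg (by positivity) (inv_nonneg.2 (hd i))
  refine ⟨∑ i, a i, fun e i hi k => ?_⟩
  have hdi := hdpos i hi
  have h1 : S.rho i (e i) k ^ 2 ≤ (S.α i ^ 2 + S.β i ^ 2 + 1) * (e i 0 ^ 2 + e i 1 ^ 2) := by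
    fin_cases k
    · simp only [rho, Matrix.mulVec, dotProduct, Fin.sum_univ_two, Fin.zero_eta, Matrix.of_apply,
        Matrix.cons_val_zero, Matrix.cons_val_one]
      nlinarith [sq_nonneg (S.α i * e i 1), sq_nonneg (S.β i * e i 0),
        sq_nonneg (S.β i * e i 1), sq_nonneg (e i 0), sq_nonneg (e i 1)]
    · simp only [rho, Matrix.mulVec, dotProduct, Fin.sum_univ_two, Fin.mk_one, Matrix.of_apply,
        Matrix.cons_val_zero, Matrix.cons_val_one]
      nlinarith [sq_nonneg (S.α i * e i 1), sq_nonneg (S.α i * e i 0),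
        sq_nonneg (S.β i * e i 1 - e i 0)]
  have h2 : (S.α i ^ 2 + S.β i ^ 2 + 1) * (e i 0 ^ 2 + e i 1 ^ 2)
      = a i * (d i * (e i 0 ^ 2 + e i 1 ^ 2)) := by
    simp only [ha]
    field_simp
  rw [h2] at h1
  refine h1.trans (mul_le_mul
    (Finset.single_le_sum (fun i _ => hann i) (Finset.mem_univ i))
    (Finset.single_le_sum (f := fun i => d i * (e i 0 ^ 2 + e i 1 ^ 2))
      (fun i _ => mul_nonneg (hd i) (by positivity)) (Finset.mem_univ i))
    (mul_nonneg hdi.le (by positivity)) (Finset.sum_nonneg fun i _ => hann i))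

lemma rho_sub (i : Fin n) (θ θ' : Fin 2 → ℝ) : S.rho i (θ - θ') = S.rho i θ - S.rho i θ' :=
  Matrix.mulVec_sub _ _ _

end SensorNetwork

/-- Convergence of random vectors that are dominated by a decaying random energy. -/
lemma ae_tendsto_of_sq_le {Ω κ : Type*} [MeasurableSpace Ω] [Fintype κ] {μ : Measure Ω}
    {X : ℕ → Ω → κ → ℝ} {L : κ → ℝ} {E : ℕ → Ω → ℝ} {K : ℝ}
    (hXE : ∀ t ω p, (X t ω p - L p) ^ 2 ≤ K * E t ω) (hE : ∀ t ω, 0 ≤ E t ω)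
    (h : ∀ᵐ ω ∂μ, Tendsto (fun t => ENNReal.ofReal √(E t ω)) atTop (𝓝 0)) :
    ∀ᵐ ω ∂μ, Tendsto (fun t => X t ω) atTop (𝓝 L) := by
  filter_upwards [h] with ω hω
  have h1 : Tendsto (fun t => √(E t ω)) atTop (𝓝 0) := by
    have := (ENNReal.tendsto_toReal ENNReal.zero_ne_top).comp hω
    simpa [Function.comp_def, ENNReal.toReal_ofReal (Real.sqrt_nonneg _)] using this
  have h2 : Tendsto (fun t => K * E t ω) atTop (𝓝 0) := by
    have := (h1.pow 2).const_mul K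
    simpa [Real.sq_sqrt (hE _ ω)] using this
  refine tendsto_pi_nhds.2 fun p => ?_
  have h3 : Tendsto (fun t => (X t ω p - L p) ^ 2) atTop (𝓝 0) :=
    squeeze_zero (fun t => sq_nonneg _) (fun t => hXE t ω p) h2
  have h4 : Tendsto (fun t => |X t ω p - L p|) atTop (𝓝 0) := by
    simpa [Real.sqrt_sq_eq_abs] using h3.sqrt
  have h5 := (tendsto_zero_iff_abs_tendsto_zero _).2 h4
  simpa using h5.add_const (L p)

lemma tendstoMeanSquare_of_sq_le {Ω κ : Type*} [MeasurableSpace Ω] [Fintype κ] {μ : Measure Ω}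
    [IsProbabilityMeasure μ]
    {X : ℕ → Ω → κ → ℝ} {L : κ → ℝ} {E : ℕ → Ω → ℝ} {K : ℝ}
    (hX : ∀ t p, Measurable fun ω => X t ω p) (hEm : ∀ t, Measurable (E t))
    (hXE : ∀ t ω p, (X t ω p - L p) ^ 2 ≤ K * E t ω) (hE : ∀ t ω, 0 ≤ E t ω)
    (hfin : ∀ t, ∫⁻ ω, ENNReal.ofReal (E t ω) ∂μ ≠ ⊤)
    (h : Tendsto (fun t => ∫⁻ ω, ENNReal.ofReal (E t ω) ∂μ) atTop (𝓝 0)) :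
    TendstoMeanSquare μ X L := by
  have hEi : ∀ t, Integrable (E t) μ := fun t => by
    refine ⟨(hEm t).aestronglyMeasurable, ?_⟩
    rw [hasFiniteIntegral_iff_ofReal (Eventually.of_forall (hE t))]
    exact (hfin t).lt_top
  have hdi : ∀ t p, Integrable (fun ω => (X t ω p - L p) ^ 2) μ := fun t p =>
    ((hEi t).const_mul K).mono' (((hX t p).sub_const _).pow_const 2).aestronglyMeasurable
      (Eventually.of_forall fun ω => by
        rw [Real.norm_of_nonneg (sq_nonneg _)]
        exact hXE t ω p)
  refine ⟨fun t p => ?_, ?_⟩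
  · have h1 : MemLp (fun ω => X t ω p - L p) 2 μ :=
      (memLp_two_iff_integrable_sq ((hX t p).sub_const _).aestronglyMeasurable).2 (hdi t p)
    simpa [Pi.add_def] using h1.add (memLp_const (L p))
  · have hEint : Tendsto (fun t => ∫ ω, E t ω ∂μ) atTop (𝓝 0) := by
      have := (ENNReal.tendsto_toReal ENNReal.zero_ne_top).comp h
      refine this.congr fun t => ?_
      rw [integral_eq_lintegral_of_nonneg_ae (Eventually.of_forall (hE t))
        (hEm t).aestronglyMeasurable]
      rfl
    refine squeeze_zero
      (fun t => integral_nonneg fun ω => Finset.sum_nonneg fun p _ => sq_nonneg _)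
      (fun t => ?_) (by simpa using hEint.const_mul (Fintype.card κ * K))
    rw [← integral_const_mul]
    refine integral_mono (integrable_finsetSum _ fun p _ => hdi t p) ((hEi t).const_mul _)
      fun ω => (Finset.sum_le_sum fun p _ => hXE t ω p).trans (le_of_eq ?_)
    simp [mul_assoc]

end

/-! ### Assembly. -/

theorem theorem7 {n : ℕ} (S : SensorNetwork n)
    {Ω : Type*} [MeasurableSpace Ω] (μ : Measure Ω) [IsProbabilityMeasure μ]
    (x : ℕ → Ω → ℝ) (xbar s : ℝ)
    -- the signal is i.i.d. with mean `xbar` and finite second moment `s ^ 2`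
    (hx_meas : ∀ t, Measurable (x t))
    (hx_indep : iIndepFun x μ)
    (hx_ident : ∀ t, IdentDistrib (x t) (x 0) μ μ)
    (hx_sq : MemLp (x 0) 2 μ)
    (hx_mean : ∫ ω, x 0 ω ∂μ = xbar)
    (hx_second : ∫ ω, x 0 ω ^ 2 ∂μ = s ^ 2)
    -- the signal has positive variance
    (hvar : 0 < s ^ 2 - xbar ^ 2)
    -- the nonempty set of sensors that are held fixed, with their calibration parameters
    (F : Finset (Fin n)) (hF : F.Nonempty) (θf : Fin n → Fin 2 → ℝ)
    -- adjusted sensors have nonzero gain and give positive weights to their neighbours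
    (hα : ∀ i, i ∉ F → S.α i ≠ 0)
    (hγ : ∀ i, i ∉ F → ∀ j ∈ S.nbr i, 0 < S.γ i j)
    -- all adjusted sensors are reachable from all fixed sensors
    (hreach : ∀ l, l ∉ F → ∀ k ∈ F, S.Reachable k l) :
    IsUnit (S.GamAdj F ⊗ₖ (1 : Matrix (Fin 2) (Fin 2) ℝ)) ∧
    ∃ δ₀ : ℝ, 0 < δ₀ ∧ ∀ δ : ℝ, 0 < δ → δ ≤ δ₀ →
      (∀ᵐ ω ∂μ, Tendsto (fun t => S.rhoAdj F θf δ (fun u => x u ω) t) atTop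
        (𝓝 (S.rhoLim F θf))) ∧
      (Integrable (fun ω => x 0 ω ^ 4) μ →
        TendstoMeanSquare μ (fun t ω => S.rhoAdj F θf δ (fun u => x u ω) t)
          (S.rhoLim F θf)) := by
  have hunit : IsUnit (S.GamAdj F ⊗ₖ (1 : Matrix (Fin 2) (Fin 2) ℝ)) := by
    have := (Matrix.isUnit_iff_isUnit_det _).1 (S.isUnit_GamAdj hF hγ hreach)
    rw [Matrix.isUnit_iff_isUnit_det, Matrix.det_kronecker]
    simpa using this.pow 2
  refine ⟨hunit, ?_⟩
  obtain ⟨d, hd, hdpos, hdF, hdeq⟩ := S.exists_weights hF hγ hreach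
  obtain ⟨C, hC, hstep⟩ := S.exists_energy_step_le hd hdpos hdF hdeq
  obtain ⟨σ, hσ, hσE⟩ := S.exists_energy_le_sum F hd hα hdF hvar
  obtain ⟨K, hK⟩ := S.exists_rho_sq_le hd hdpos
  obtain ⟨θs, hθsF, hθsρ, hθs⟩ := S.exists_equilibrium hα hunit θf
  set ν := μ.map (x 0) with hν
  have hνp : IsProbabilityMeasure ν := Measure.isProbabilityMeasure_map (hx_meas 0).aemeasurable
  have hνt : ∀ t, μ.map (x t) = ν := fun t => (hx_ident t).map_eq
  have hpow : ∀ k : ℕ, Integrable (fun ξ : ℝ => ξ ^ k) ν ↔ Integrable (fun ω => x 0 ω ^ k) μ :=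
    fun k => integrable_map_measure (by fun_prop) (hx_meas 0).aemeasurable
  have hi1 : Integrable (fun ξ : ℝ => ξ) ν :=
    (integrable_map_measure (by fun_prop) (hx_meas 0).aemeasurable).2
      (hx_sq.integrable one_le_two)
  have hi2 : Integrable (fun ξ : ℝ => ξ ^ 2) ν := (hpow 2).2 hx_sq.integrable_sq
  have hm1 : ∫ ξ, ξ ∂ν = xbar := by
    rw [hν, integral_map (hx_meas 0).aemeasurable (by fun_prop), hx_mean]
  have hm2 : ∫ ξ, ξ ^ 2 ∂ν = s ^ 2 := by
    rw [hν, integral_map (hx_meas 0).aemeasurable (by fun_prop), hx_second]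
  have hσW : ∀ e, σ * SensorNetwork.energy d e ≤ ∫ ξ, S.outSq e ξ ∂ν := fun e => by
    rw [(S.integrable_outSq hi1 hi2 e).2, hm1, hm2]
    exact hσE e
  have hWi := fun e => (S.integrable_outSq hi1 hi2 e).1
  set e : ℝ → ℕ → Ω → Fin n → Fin 2 → ℝ := fun δ t ω =>
    S.theta F θf δ (fun u => x u ω) t - θs with he
  have hesucc : ∀ δ t ω, e δ (t + 1) ω = S.step F δ (e δ t ω) (x t ω) := fun δ t ω => by
    simp only [he]
    rw [S.theta_succ, S.step_sub δ _ θs (x t ω) fun i hi => hθs i hi _]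
  have heF : ∀ δ t ω, ∀ i ∈ F, e δ t ω i = 0 := fun δ t ω i hi => by
    simp [he, S.theta_of_mem θf δ _ t hi, hθsF i hi]
  have hθm : ∀ δ t, Measurable fun ω => S.theta F θf δ (fun u => x u ω) t := fun δ t =>
    (S.measurable_theta F θf δ t).comp (measurable_pi_lambda _ hx_meas)
  have hem : ∀ δ t, Measurable (e δ t) := fun δ t => (hθm δ t).sub_const θs
  have heind : ∀ δ t, IndepFun (e δ t) (x t) μ := fun δ t =>
    (S.indepFun_theta hx_meas hx_indep F θf δ t).comp
      (φ := fun θ => θ - θs) (measurable_id.sub_const θs) measurable_id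
  have hXE : ∀ δ t ω (p : {i // i ∉ F} × Fin 2),
      (S.rhoAdj F θf δ (fun u => x u ω) t p - S.rhoLim F θf p) ^ 2
        ≤ K * SensorNetwork.energy d (e δ t ω) := fun δ t ω p => by
    have h1 := hK (e δ t ω) p.1 p.1.2 p.2
    have h2 : S.rho p.1 (e δ t ω p.1) p.2 =
        S.rhoAdj F θf δ (fun u => x u ω) t p - S.rhoLim F θf p := by
      rw [← hθsρ p]
      exact congrFun (S.rho_sub p.1 _ _) p.2
    rwa [h2] at h1
  have hEnn : ∀ δ t ω, 0 ≤ SensorNetwork.energy d (e δ t ω) := fun δ t ω =>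
    SensorNetwork.energy_nonneg hd _
  have hEm : ∀ δ t, Measurable fun ω => SensorNetwork.energy d (e δ t ω) := fun δ t =>
    (SensorNetwork.measurable_energy d).comp (hem δ t)
  -- The initial error is deterministic, so the initial integrals are finite.
  have he0 : ∀ δ ω, e δ 0 ω = S.theta F θf δ 0 0 - θs := fun _ _ => rfl
  -- Stated for general φ so as to serve both √V and V.
  have hiter : ∀ (φ : ℝ → ENNReal), Measurable φ → ∀ (δ : ℝ) (q : ENNReal), q ≠ ⊤ →
      (∀ a : Fin n → Fin 2 → ℝ, (∀ i ∈ F, a i = 0) →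
        ∫⁻ ξ, φ (SensorNetwork.energy d (S.step F δ a ξ)) ∂ν ≤ q * φ (SensorNetwork.energy d a)) →
      ∀ t, ∫⁻ ω, φ (SensorNetwork.energy d (e δ (t + 1) ω)) ∂μ
        ≤ q * ∫⁻ ω, φ (SensorNetwork.energy d (e δ t ω)) ∂μ := by
    intro φ hφ δ q hq h t
    simp_rw [hesucc]
    refine (heind δ t).lintegral_le_of_forall (hem δ t) (hx_meas t)
      (f := fun p => φ (SensorNetwork.energy d (S.step F δ p.1 p.2)))
      (g := fun a => φ (SensorNetwork.energy d a))
      (hφ.comp ((SensorNetwork.measurable_energy d).comp (S.measurable_step F δ))) hq fun ω => ?_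
    rw [hνt t]
    exact h _ (heF δ t ω)
  obtain ⟨δ₁, hδ₁, hcon₁⟩ := exists_sqrt_contraction hi2 hC hσ
  have hsure : ∀ δ, 0 < δ → δ ≤ δ₁ → ∀ᵐ ω ∂μ,
      Tendsto (fun t => S.rhoAdj F θf δ (fun u => x u ω) t) atTop (𝓝 (S.rhoLim F θf)) := by
    intro δ hδ hδle
    obtain ⟨hq, hcon⟩ := hcon₁ δ hδ hδle
    refine ae_tendsto_of_sq_le (hXE δ) (hEnn δ) ?_
    refine ae_tendsto_zero_of_geometric (q := ENNReal.ofReal (1 - δ * σ / 8))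
      (fun t => (hEm δ t).sqrt.ennreal_ofReal) (ENNReal.ofReal_lt_one.2 ?_) ?_ ?_
    · have := mul_pos hδ hσ
      linarith
    · simp [he0]
    · exact hiter (fun v => ENNReal.ofReal √v) (by fun_prop) δ _ ENNReal.ofReal_ne_top
        fun a ha => hcon _ _ (S.outSq a) (SensorNetwork.energy_nonneg hd a)
          (fun ξ => SensorNetwork.energy_nonneg hd _)
          (S.outSq_nonneg a) (hWi a) (hσW a) (fun ξ => (hstep a ha ξ).1)
          fun ξ => (hstep a ha ξ).2 δ hδ.le
  -- The step size bound is chosen before the fourth moment is assumed, yet depends on it; without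
  -- it the mean square claim is vacuous.
  by_cases h4 : Integrable (fun ω => x 0 ω ^ 4) μ
  · obtain ⟨δ₂, hδ₂, hcon₂⟩ := exists_contraction hi2 ((hpow 4).2 h4) hC hσ
    refine ⟨min δ₁ δ₂, lt_min hδ₁ hδ₂, fun δ hδ hδle =>
      ⟨hsure δ hδ (hδle.trans (min_le_left _ _)), fun _ => ?_⟩⟩
    obtain ⟨hq, hcon⟩ := hcon₂ δ hδ (hδle.trans (min_le_right _ _))
    set q := ENNReal.ofReal (1 - δ * σ / 2) with hqdef
    have hq1 : q < 1 := ENNReal.ofReal_lt_one.2 (by have := mul_pos hδ hσ; linarith)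
    have hgeo := le_pow_mul_of_forall_succ_le
      (hiter ENNReal.ofReal ENNReal.measurable_ofReal δ q ENNReal.ofReal_ne_top
        fun a ha => hcon _ _ (S.outSq a) (SensorNetwork.energy_nonneg hd a)
          (fun ξ => SensorNetwork.energy_nonneg hd _)
          (hWi a) (hσW a) (fun ξ => (hstep a ha ξ).1) fun ξ => (hstep a ha ξ).2 δ hδ.le)
    have h0 : ∫⁻ ω, ENNReal.ofReal (SensorNetwork.energy d (e δ 0 ω)) ∂μ ≠ ⊤ := by simp [he0]
    refine tendstoMeanSquare_of_sq_le (fun t p => ?_) (hEm δ) (hXE δ) (hEnn δ) (fun t => ?_) ?_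
    · have : Measurable fun θ : Fin n → Fin 2 → ℝ => S.rho p.1 (θ p.1) p.2 := by
        simp only [SensorNetwork.rho, Matrix.mulVec, dotProduct]
        fun_prop
      exact this.comp (hθm δ t)
    · exact ne_top_of_le_ne_top
        (ENNReal.mul_ne_top (ENNReal.pow_ne_top ENNReal.ofReal_ne_top) h0) (hgeo t)
    · refine tendsto_of_tendsto_of_tendsto_of_le_of_le tendsto_const_nhds ?_
        (fun t => zero_le) hgeo
      simpa using ENNReal.Tendsto.mul_const
        (ENNReal.tendsto_pow_atTop_nhds_zero_of_lt_one hq1) (Or.inr h0)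
  · exact ⟨δ₁, hδ₁, fun δ hδ hδle => ⟨hsure δ hδ hδle, fun h => absurd h h4⟩⟩
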